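/- For integers $k\ge 2$ and $n,p,q\ge 1$, an edge-coloring of the complete $k$-uniform hypergraph $K_n^{(k)}$ (whose edges are all $k$-element subsets of an $n$-element vertex set) is called a $(p,q)$-coloring if the edges inside every set of $p$ vertices receive at least $q$ distinct colors. Let $f_k(n,p,q)$ be the minimum number of colors in a $(p,q)$-coloring of $K_n^{(k)}$. Let $\log_{(0)}x=x$ and $\log_{(i+1)}x=\log\log_{(i)}x$ for $i\ge 0$. Theorem. For every fixed integer $k\ge 4$, as $n\to\infty$, $$f_k(n,k+2,3)=e^{O\left(\sqrt{\log_{(k-1)}n}\right)}=(\log_{(k-2)}n)^{o(1)},$$ where the implied constant and the rate of the $o(1)$ term may depend on $k$. That is, for all sufficiently large $n$ one has $f_k(n,k+2,3)=e^{h(n)}$ for a function $h$ with $h(n)=O\left(\sqrt{\log_{(k-1)}n}\right)$, and $f_k(n,k+2,3)=(\log_{(k-2)}n)^{\varepsilon(n)}$ for a function $\varepsilon$ with $\varepsilon(n)\to 0$. -/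

import Mathlib

open Filter Topology Asymptotics

/-- The edges of the complete `k`-uniform hypergraph on the vertex set `V`:
the `k`-element subsets of `V`. -/
abbrev CompleteEdge (V : Type*) (k : ℕ) : Type _ := {e : Finset V // e.card = k}

/-- An edge-coloring `χ` of the complete `k`-uniform hypergraph on `V` is a `(p, q)`-coloring if
the edges inside every set of `p` vertices receive at least `q` distinct colors. -/
def IsPQColoring {V C : Type*} {k : ℕ} (p q : ℕ) (χ : CompleteEdge V k → C) : Prop :=
  ∀ S : Finset V, S.card = p → q ≤ (χ '' {e : CompleteEdge V k | e.1 ⊆ S}).ncard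

/-- The Erdős–Gyárfás function `f_k(n, p, q)`: the minimum number of colors in a
`(p, q)`-coloring of the complete `k`-uniform hypergraph on `n` vertices. -/
noncomputable def erdosGyarfas (k n p q : ℕ) : ℕ :=
  sInf {r : ℕ | ∃ χ : CompleteEdge (Fin n) k → Fin r, IsPQColoring p q χ}

/-!
Only the upper bound on the number of colors has content, since the number of colors is at least
`1` and its logarithm is therefore non-negative.

The starting point is a coloring of pairs of words in `B ^ t`, `B = {0, 1} ^ t`: a pair is colored by
the set of coordinates in which the words agree, together with the unordered pair of letters at one
coordinate, chosen from that set, where they differ. This uses at most `8 ^ t` colors on `2 ^ t ^ 2`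
vertices. It is fork-free: `χ(ra) = χ(bc)` forces the letter of `r` at the chosen coordinate to be
that of exactly one of `b`, `c`, which excludes `χ(rb) = χ(rc)` (`blockColor_fork`). Fork-freeness
yields two colors on three vertices and three colors on four vertices (`IsForkFree.isGood`).

The uniformity is then raised by stepping up. Order the words in `{0, 1} ^ n` lexicographically and
let `δ(a, b)` be the first coordinate in which `a` and `b` differ. A `(k + 1)`-set is colored by the
shape of the binary tree it spans and by the old color of the splitting points of its consecutive
elements. The induction carries the property `IsGood`: two colors on `k + 1` vertices and three on
`k + 2`. If the splitting points of the given vertices are monotone, the colors are inherited.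
Otherwise one looks at the up-down word of consecutive splitting points. The windows of this word
obtained by omitting end vertices have different shapes, unless the word is nearly constant, so that
a large monotone subset provides two colors and a non-monotone set the third, or the word
alternates (`seesThree_stepUp_or_alternating`). In an alternating word, deleting a vertex at a local
maximum of the splitting points creates a repeated letter and so a third shape; for triples this
fails for one tree and its mirror image, which is where fork-freeness is used (`seesThree_five`).

Each step replaces `n` vertices and `r` colors by `2 ^ n` vertices and a constant times `r ^ 2`
colors, so that `A ^ t` colors suffice for a tower over `2 ^ t ^ 2` of height `k - 2`
(`exists_hasGoodColoring`). The `(k - 1)`-fold iterated logarithm of such a tower is of order `t ^ 2`.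
-/

variable {V W C D : Type*} {k m n : ℕ}

/-! ### Colorings of sequences and the step-up coloring -/

/-- The sub-`k`-sequences of `v` receive at least two colors. Colorings are functions of sequences;
an edge is represented by its increasing enumeration. -/
def SeesTwo (χ : (Fin k → V) → C) (v : Fin m → V) : Prop :=
  ∃ f g : Fin k ↪o Fin m, χ (v ∘ f) ≠ χ (v ∘ g)

/-- The sub-`k`-sequences of `v` receive at least three colors. -/
def SeesThree (χ : (Fin k → V) → C) (v : Fin m → V) : Prop :=
  ∃ f g h : Fin k ↪o Fin m, χ (v ∘ f) ≠ χ (v ∘ g) ∧ χ (v ∘ g) ≠ χ (v ∘ h) ∧ χ (v ∘ f) ≠ χ (v ∘ h)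

/-- The property carried through the induction: besides three colors inside every `k + 2` vertices,
it asks for two colors inside every `k + 1` vertices. Only increasing sequences matter. -/
structure IsGood [LinearOrder V] (χ : (Fin k → V) → C) : Prop where
  two : ∀ v : Fin (k + 1) → V, StrictMono v → SeesTwo χ v
  three : ∀ v : Fin (k + 2) → V, StrictMono v → SeesThree χ v

/-- `δ` behaves like the first coordinate in which two words differ, for words ordered
lexicographically. Nothing is required of `δ a b` unless `a < b`. -/
def IsSplitting [LinearOrder V] [LinearOrder W] (δ : W → W → V) : Prop :=
  ∀ a b c, a < b → b < c → δ a b ≠ δ b c ∧ δ a c = min (δ a b) (δ b c)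

/-- The splitting points of consecutive terms of `u`. -/
def deltaSeq (δ : W → W → V) (u : Fin (k + 1) → W) : Fin k → V :=
  fun i => δ (u i.castSucc) (u i.succ)

/-- The up-down pattern of the splitting points on all triples. It determines the binary tree in
which the terms of an increasing `u` are the leaves. -/
def shape [LinearOrder V] (δ : W → W → V) (u : Fin m → W) : Fin m → Fin m → Fin m → Bool :=
  fun i j l => decide (δ (u i) (u j) < δ (u j) (u l))

/-- The stepped-up coloring: the shape, together with the old colors of the sequence of splitting
points read in both directions. If the splitting points increase or decrease, one of the two
readings is the increasing enumeration of an edge; otherwise both values are irrelevant. -/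
def stepUp [LinearOrder V] (δ : W → W → V) (χ : (Fin k → V) → C) (u : Fin (k + 1) → W) :
    (Fin (k + 1) → Fin (k + 1) → Fin (k + 1) → Bool) × C × C :=
  (shape δ u, χ (deltaSeq δ u), χ (deltaSeq δ u ∘ Fin.rev))

section
variable [LinearOrder V] {δ : W → W → V} {χ : (Fin k → V) → C}

lemma stepUp_ne_of_shape {u u' : Fin (k + 1) → W} (i j l : Fin (k + 1))
    (h : ¬ (δ (u i) (u j) < δ (u j) (u l) ↔ δ (u' i) (u' j) < δ (u' j) (u' l))) :
    stepUp δ χ u ≠ stepUp δ χ u' := by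
  intro he
  have := congrFun (congrFun (congrFun (congrArg Prod.fst he) i) j) l
  simp only [stepUp, shape, decide_eq_decide] at this
  exact h this

lemma strictMono_of_lt_next {f : Fin m → V}
    (h : ∀ p (hp : p + 1 < m), f ⟨p, by omega⟩ < f ⟨p + 1, hp⟩) : StrictMono f := by
  cases m with
  | zero => exact fun i => i.elim0
  | succ m => exact Fin.strictMono_iff_lt_succ.2 fun i => h i.1 (by omega)

lemma strictAnti_of_next_lt {f : Fin m → V}
    (h : ∀ p (hp : p + 1 < m), f ⟨p + 1, hp⟩ < f ⟨p, by omega⟩) : StrictAnti f := by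
  cases m with
  | zero => exact fun i => i.elim0
  | succ m => exact Fin.strictAnti_iff_succ_lt.2 fun i => h i.1 (by omega)

lemma stepUp_ne_of_deltaSeq {u u' : Fin (k + 1) → W}
    (h : χ (deltaSeq δ u) ≠ χ (deltaSeq δ u')) : stepUp δ χ u ≠ stepUp δ χ u' :=
  fun he => h (congrArg (fun z => z.2.1) he)

lemma stepUp_ne_of_deltaSeq_rev {u u' : Fin (k + 1) → W}
    (h : χ (deltaSeq δ u ∘ Fin.rev) ≠ χ (deltaSeq δ u' ∘ Fin.rev)) :
    stepUp δ χ u ≠ stepUp δ χ u' :=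
  fun he => h (congrArg (fun z => z.2.2) he)

/-- An increasing and a non-increasing sequence of splitting points give different colors. -/
lemma stepUp_ne_of_strictMono {u u' : Fin (k + 1) → W} (hu : StrictMono (deltaSeq δ u))
    (p : ℕ) (hp : p + 1 < k)
    (hu' : ¬ deltaSeq δ u' ⟨p, by omega⟩ < deltaSeq δ u' ⟨p + 1, hp⟩) :
    stepUp δ χ u ≠ stepUp δ χ u' := by
  refine stepUp_ne_of_shape ⟨p, by omega⟩ ⟨p + 1, by omega⟩ ⟨p + 1 + 1, by omega⟩ fun h => hu' ?_
  exact h.1 (hu (a := ⟨p, by omega⟩) (b := ⟨p + 1, hp⟩) (Fin.lt_def.2 (by simp only; omega)))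

/-- A decreasing and a non-decreasing sequence of splitting points give different colors. -/
lemma stepUp_ne_of_strictAnti {u u' : Fin (k + 1) → W} (hu : StrictAnti (deltaSeq δ u))
    (p : ℕ) (hp : p + 1 < k)
    (hu' : deltaSeq δ u' ⟨p, by omega⟩ < deltaSeq δ u' ⟨p + 1, hp⟩) :
    stepUp δ χ u ≠ stepUp δ χ u' := by
  refine stepUp_ne_of_shape ⟨p, by omega⟩ ⟨p + 1, by omega⟩ ⟨p + 1 + 1, by omega⟩ fun h => ?_
  exact lt_asymm (hu (a := ⟨p, by omega⟩) (b := ⟨p + 1, hp⟩) (Fin.lt_def.2 (by simp only; omega)))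
    (h.2 hu')

variable [LinearOrder W]

/-- Along a set whose consecutive splitting points increase, a pair splits where its smaller
element splits from its successor. -/
lemma splitting_of_strictMono (hδ : IsSplitting δ) {v : Fin (m + 1) → W} (hv : StrictMono v)
    (hd : StrictMono (deltaSeq δ v)) (a b : Fin (m + 1)) (hab : a < b) :
    δ (v a) (v b) = deltaSeq δ v ⟨a, by omega⟩ := by
  suffices H : ∀ s : ℕ, ∀ hs : a.1 + 1 + s < m + 1,
      δ (v a) (v ⟨a.1 + 1 + s, hs⟩) = deltaSeq δ v ⟨a, by omega⟩ by
    rw [← H (b.1 - (a.1 + 1)) (by omega)]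
    congr 2
    apply Fin.ext
    simp only
    omega
  intro s
  induction s with
  | zero => exact fun _ => rfl
  | succ s ih =>
    intro hs
    have h1 := ih (by omega)
    have h2 := (hδ (v a) (v ⟨a.1 + 1 + s, by omega⟩) (v ⟨a.1 + 1 + (s + 1), hs⟩)
      (hv (Fin.lt_def.2 (by simp only; omega))) (hv (Fin.lt_def.2 (by simp only; omega)))).2
    have h3 : deltaSeq δ v ⟨a, by omega⟩ < deltaSeq δ v ⟨a.1 + 1 + s, by omega⟩ :=
      hd (Fin.lt_def.2 (by simp only; omega))
    rw [h2, h1]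
    exact min_eq_left h3.le

/-- Along a set whose consecutive splitting points decrease, a pair splits where its larger
element splits from its predecessor. -/
lemma splitting_of_strictAnti (hδ : IsSplitting δ) {v : Fin (m + 1) → W} (hv : StrictMono v)
    (hd : StrictAnti (deltaSeq δ v)) (a b : Fin (m + 1)) (hab : a < b) :
    δ (v a) (v b) = deltaSeq δ v ⟨b - 1, by omega⟩ := by
  suffices H : ∀ s : ℕ, ∀ hs : a.1 + s < m,
      δ (v a) (v ⟨a.1 + s + 1, by omega⟩) = deltaSeq δ v ⟨a + s, hs⟩ by
    have := H (b.1 - (a.1 + 1)) (by omega)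
    convert this using 2
    · congr 1
      apply Fin.ext
      simp only
      omega
    · apply Fin.ext
      simp only
      omega
  intro s
  induction s with
  | zero => exact fun _ => rfl
  | succ s ih =>
    intro hs
    have h1 := ih (by omega)
    have h2 := (hδ (v a) (v ⟨a.1 + s + 1, by omega⟩) (v ⟨a.1 + (s + 1) + 1, by omega⟩)
      (hv (Fin.lt_def.2 (by simp only; omega))) (hv (Fin.lt_def.2 (by simp only; omega)))).2
    have h3 : deltaSeq δ v ⟨a.1 + (s + 1), hs⟩ < deltaSeq δ v ⟨a.1 + s, by omega⟩ :=
      hd (Fin.lt_def.2 (by simp only; omega))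
    rw [h2, h1]
    exact min_eq_right h3.le

/-- Every selection among increasing splitting points is realized by a selection of vertices, the last
vertex always being kept. -/
lemma exists_deltaSeq_comp_of_strictMono (hδ : IsSplitting δ) {v : Fin (m + 1) → W}
    (hv : StrictMono v) (hd : StrictMono (deltaSeq δ v)) (g : Fin k ↪o Fin m) :
    ∃ f : Fin (k + 1) ↪o Fin (m + 1), deltaSeq δ (v ∘ f) = deltaSeq δ v ∘ g := by
  have hf : StrictMono (fun i : Fin (k + 1) =>
      if h : i.1 < k then (g ⟨i.1, h⟩).castSucc else Fin.last m) := by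
    refine Fin.strictMono_iff_lt_succ.2 fun i => ?_
    by_cases h : i.1 + 1 < k
    · simp [h, Fin.lt_def]
    · simp [h, Fin.castSucc_lt_last]
  refine ⟨OrderEmbedding.ofStrictMono _ hf, funext fun i => ?_⟩
  simp only [deltaSeq, Function.comp_apply]
  rw [splitting_of_strictMono hδ hv hd _ _ ((OrderEmbedding.lt_iff_lt _).2
    Fin.castSucc_lt_succ)]
  simp [deltaSeq]

/-- Every selection among decreasing splitting points is realized by a selection of vertices, the
first vertex always being kept. -/
lemma exists_deltaSeq_comp_of_strictAnti (hδ : IsSplitting δ) {v : Fin (m + 1) → W}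
    (hv : StrictMono v) (hd : StrictAnti (deltaSeq δ v)) (g : Fin k ↪o Fin m) :
    ∃ f : Fin (k + 1) ↪o Fin (m + 1), deltaSeq δ (v ∘ f) = deltaSeq δ v ∘ g := by
  have hf : StrictMono (fun i : Fin (k + 1) =>
      if h : 0 < i.1 then (g ⟨i.1 - 1, by omega⟩).succ else 0) := by
    refine Fin.strictMono_iff_lt_succ.2 fun i => ?_
    by_cases h : 0 < i.1
    · simp [h, Fin.lt_def]
    · simp [h]
  refine ⟨OrderEmbedding.ofStrictMono _ hf, funext fun i => ?_⟩
  simp only [deltaSeq, Function.comp_apply]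
  rw [splitting_of_strictAnti hδ hv hd _ _ ((OrderEmbedding.lt_iff_lt _).2
    Fin.castSucc_lt_succ)]
  simp [deltaSeq]

lemma exists_deltaSeq_comp_rev (hδ : IsSplitting δ) {v : Fin (m + 1) → W}
    (hv : StrictMono v) (hd : StrictAnti (deltaSeq δ v)) (g : Fin k ↪o Fin m) :
    ∃ f : Fin (k + 1) ↪o Fin (m + 1),
      deltaSeq δ (v ∘ f) ∘ Fin.rev = (deltaSeq δ v ∘ Fin.rev) ∘ g := by
  have hg : StrictMono (Fin.rev ∘ g ∘ Fin.rev) := fun a b hab => by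
    simpa [Fin.rev_lt_rev] using hab
  obtain ⟨f, hf⟩ := exists_deltaSeq_comp_of_strictAnti hδ hv hd (OrderEmbedding.ofStrictMono _ hg)
  refine ⟨f, ?_⟩
  rw [hf]
  funext i
  simp

lemma SeesThree.stepUp_of_strictMono (hδ : IsSplitting δ) {v : Fin (m + 1) → W}
    (hv : StrictMono v) (hd : StrictMono (deltaSeq δ v)) (h : SeesThree χ (deltaSeq δ v)) :
    SeesThree (stepUp δ χ) v := by
  obtain ⟨g₁, g₂, g₃, h₁₂, h₂₃, h₁₃⟩ := h
  obtain ⟨f₁, hf₁⟩ := exists_deltaSeq_comp_of_strictMono hδ hv hd g₁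
  obtain ⟨f₂, hf₂⟩ := exists_deltaSeq_comp_of_strictMono hδ hv hd g₂
  obtain ⟨f₃, hf₃⟩ := exists_deltaSeq_comp_of_strictMono hδ hv hd g₃
  rw [← hf₁, ← hf₂] at h₁₂
  rw [← hf₂, ← hf₃] at h₂₃
  rw [← hf₁, ← hf₃] at h₁₃
  exact ⟨f₁, f₂, f₃, stepUp_ne_of_deltaSeq h₁₂, stepUp_ne_of_deltaSeq h₂₃,
    stepUp_ne_of_deltaSeq h₁₃⟩

lemma SeesThree.stepUp_of_strictAnti (hδ : IsSplitting δ) {v : Fin (m + 1) → W}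
    (hv : StrictMono v) (hd : StrictAnti (deltaSeq δ v))
    (h : SeesThree χ (deltaSeq δ v ∘ Fin.rev)) :
    SeesThree (stepUp δ χ) v := by
  obtain ⟨g₁, g₂, g₃, h₁₂, h₂₃, h₁₃⟩ := h
  obtain ⟨f₁, hf₁⟩ := exists_deltaSeq_comp_rev hδ hv hd g₁
  obtain ⟨f₂, hf₂⟩ := exists_deltaSeq_comp_rev hδ hv hd g₂
  obtain ⟨f₃, hf₃⟩ := exists_deltaSeq_comp_rev hδ hv hd g₃
  rw [← hf₁, ← hf₂] at h₁₂
  rw [← hf₂, ← hf₃] at h₂₃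
  rw [← hf₁, ← hf₃] at h₁₃
  exact ⟨f₁, f₂, f₃, stepUp_ne_of_deltaSeq_rev h₁₂, stepUp_ne_of_deltaSeq_rev h₂₃,
    stepUp_ne_of_deltaSeq_rev h₁₃⟩

lemma SeesTwo.stepUp_of_strictMono (hδ : IsSplitting δ) {v : Fin (m + 1) → W}
    (hv : StrictMono v) (hd : StrictMono (deltaSeq δ v)) (h : SeesTwo χ (deltaSeq δ v)) :
    ∃ f g : Fin (k + 1) ↪o Fin (m + 1), stepUp δ χ (v ∘ f) ≠ stepUp δ χ (v ∘ g) ∧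
      StrictMono (deltaSeq δ (v ∘ f)) ∧ StrictMono (deltaSeq δ (v ∘ g)) := by
  obtain ⟨g₁, g₂, h₁₂⟩ := h
  obtain ⟨f₁, hf₁⟩ := exists_deltaSeq_comp_of_strictMono hδ hv hd g₁
  obtain ⟨f₂, hf₂⟩ := exists_deltaSeq_comp_of_strictMono hδ hv hd g₂
  rw [← hf₁, ← hf₂] at h₁₂
  exact ⟨f₁, f₂, stepUp_ne_of_deltaSeq h₁₂, hf₁ ▸ hd.comp g₁.strictMono,
    hf₂ ▸ hd.comp g₂.strictMono⟩

lemma SeesTwo.stepUp_of_strictAnti (hδ : IsSplitting δ) {v : Fin (m + 1) → W}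
    (hv : StrictMono v) (hd : StrictAnti (deltaSeq δ v))
    (h : SeesTwo χ (deltaSeq δ v ∘ Fin.rev)) :
    ∃ f g : Fin (k + 1) ↪o Fin (m + 1), stepUp δ χ (v ∘ f) ≠ stepUp δ χ (v ∘ g) ∧
      StrictAnti (deltaSeq δ (v ∘ f)) ∧ StrictAnti (deltaSeq δ (v ∘ g)) := by
  obtain ⟨g₁, g₂, h₁₂⟩ := h
  obtain ⟨f₁, hf₁⟩ := exists_deltaSeq_comp_rev hδ hv hd g₁
  obtain ⟨f₂, hf₂⟩ := exists_deltaSeq_comp_rev hδ hv hd g₂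
  have hr : StrictMono (deltaSeq δ v ∘ Fin.rev) := hd.comp Fin.rev_strictAnti
  have key : ∀ d : Fin k → V, StrictMono (d ∘ Fin.rev) → StrictAnti d := fun d h => by
    have := h.comp_strictAnti (Fin.rev_strictAnti (n := k))
    simpa [Function.comp_assoc, Fin.rev_involutive.comp_self] using this
  have a₁ := key (deltaSeq δ (v ∘ f₁)) (hf₁ ▸ hr.comp g₁.strictMono)
  have a₂ := key (deltaSeq δ (v ∘ f₂)) (hf₂ ▸ hr.comp g₂.strictMono)
  rw [← hf₁, ← hf₂] at h₁₂
  exact ⟨f₁, f₂, stepUp_ne_of_deltaSeq_rev h₁₂, a₁, a₂⟩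

/-- Two colors inside a `(k + 2)`-set with increasing splitting points, and a third from a set
whose splitting points do not increase. -/
lemma SeesThree.of_strictMono_comp (hδ : IsSplitting δ) (hχ : IsGood χ) {v : Fin m → W}
    (hv : StrictMono v) (e : Fin (k + 2) ↪o Fin m) (he : StrictMono (deltaSeq δ (v ∘ e)))
    (h : Fin (k + 1) ↪o Fin m) (p : ℕ) (hp : p + 1 < k)
    (hh : ¬ deltaSeq δ (v ∘ h) ⟨p, by omega⟩ < deltaSeq δ (v ∘ h) ⟨p + 1, hp⟩) :
    SeesThree (stepUp δ χ) v := by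
  obtain ⟨f, g, hfg, hf, hg⟩ :=
    (hχ.two _ he).stepUp_of_strictMono hδ (hv.comp e.strictMono) he
  exact ⟨f.trans e, g.trans e, h, hfg, stepUp_ne_of_strictMono hg p hp hh,
    stepUp_ne_of_strictMono hf p hp hh⟩

/-- Two colors inside a `(k + 2)`-set with decreasing splitting points, and a third from a set whose
splitting points do not decrease. -/
lemma SeesThree.of_strictAnti_comp (hδ : IsSplitting δ) (hχ : IsGood χ) {v : Fin m → W}
    (hv : StrictMono v) (e : Fin (k + 2) ↪o Fin m) (he : StrictAnti (deltaSeq δ (v ∘ e)))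
    (h : Fin (k + 1) ↪o Fin m) (p : ℕ) (hp : p + 1 < k)
    (hh : deltaSeq δ (v ∘ h) ⟨p, by omega⟩ < deltaSeq δ (v ∘ h) ⟨p + 1, hp⟩) :
    SeesThree (stepUp δ χ) v := by
  obtain ⟨f, g, hfg, hf, hg⟩ :=
    (hχ.two _ (he.comp Fin.rev_strictAnti)).stepUp_of_strictAnti hδ (hv.comp e.strictMono) he
  exact ⟨f.trans e, g.trans e, h, hfg, stepUp_ne_of_strictAnti hg p hp hh,
    stepUp_ne_of_strictAnti hf p hp hh⟩

end

/-! ### Up-down words -/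

/-- The increasing selection of `k` out of `m` positions given by a function on `ℕ`. -/
def natEmb (f : ℕ → ℕ) (hf : ∀ i j, i < j → j < k → f i < f j) (hb : ∀ i < k, f i < m) :
    Fin k ↪o Fin m :=
  OrderEmbedding.ofStrictMono (fun i => ⟨f i, hb i i.2⟩) fun i j hij =>
    Fin.lt_def.2 (hf i j hij j.2)

lemma iff_of_iff_succ {L : ℕ → Prop} {a b : ℕ}
    (h : ∀ p, a ≤ p → p + 1 < b → (L p ↔ L (p + 1))) : ∀ p, a ≤ p → p < b → (L p ↔ L a) := by
  intro p hap hpb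
  induction p, hap using Nat.le_induction with
  | base => rfl
  | succ p hap ih => exact (h p hap hpb).symm.trans (ih (by omega))

/-- Indexing by `ℕ` avoids bounds on indices; the values beyond `m` play no role. -/
lemma exists_nat_extension [Nonempty W] (v : Fin m → W) : ∃ x : ℕ → W, v = fun i : Fin m => x i :=
  ⟨fun i => if h : i < m then v ⟨i, h⟩ else Classical.arbitrary W, by funext i; simp⟩

section
variable [LinearOrder V] {δ : W → W → V} {χ : (Fin k → V) → C}

/-- `δ` ascends at position `p` of the sequence `x`. -/
def Ascent (δ : W → W → V) (x : ℕ → W) (p : ℕ) : Prop :=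
  δ (x p) (x (p + 1)) < δ (x (p + 1)) (x (p + 1 + 1))

lemma strictMono_deltaSeq {x : ℕ → W} {a : ℕ}
    (h : ∀ p, p + 1 < m → Ascent δ x (a + p)) :
    StrictMono (deltaSeq δ (fun i : Fin (m + 1) => x (a + i))) :=
  strictMono_of_lt_next fun p hp => h p hp

variable [LinearOrder W]

lemma IsSplitting.lt_of_not_lt (hδ : IsSplitting δ) {a b c : W} (hab : a < b) (hbc : b < c)
    (h : ¬ δ a b < δ b c) : δ b c < δ a b :=
  lt_of_le_of_ne (not_lt.1 h) (hδ a b c hab hbc).1.symm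

lemma strictAnti_deltaSeq (hδ : IsSplitting δ) {x : ℕ → W} {a : ℕ}
    (hx : ∀ i j, i < j → j < a + m + 1 → x i < x j)
    (h : ∀ p, p + 1 < m → ¬ Ascent δ x (a + p)) :
    StrictAnti (deltaSeq δ (fun i : Fin (m + 1) => x (a + i))) :=
  strictAnti_of_next_lt fun p hp => hδ.lt_of_not_lt (hx _ _ (by simp) (by simp; omega))
    (hx _ _ (by simp) (by simp; omega)) (h p hp)

/-- If `k + 2` vertices do not have monotone splitting points, omitting the first and omitting the last
vertex shift the up-down word against itself, so the two shapes differ. -/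
lemma seesTwo_stepUp (hδ : IsSplitting δ) (hχ : IsGood χ)
    (v : Fin (k + 2) → W) (hv : StrictMono v) : SeesTwo (stepUp δ χ) v := by
  have : Nonempty W := ⟨v 0⟩
  obtain ⟨x, rfl⟩ := exists_nat_extension v
  have hx : ∀ i j, i < j → j < k + 2 → x i < x j := fun i j hij hj =>
    hv (a := ⟨i, by omega⟩) (b := ⟨j, hj⟩) hij
  by_cases hc : ∀ p, 0 ≤ p → p + 1 < k → (Ascent δ x p ↔ Ascent δ x (p + 1))
  · have hc' := iff_of_iff_succ hc
    by_cases h0 : Ascent δ x 0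
    · have hd := strictMono_deltaSeq (m := k + 1) (a := 0) (x := x) (δ := δ) fun p hp => by
        rw [Nat.zero_add]; exact (hc' p (by omega) (by omega)).2 h0
      simp only [Nat.zero_add] at hd
      obtain ⟨f, g, h, -⟩ := (hχ.two _ hd).stepUp_of_strictMono hδ hv hd
      exact ⟨f, g, h⟩
    · have hd := strictAnti_deltaSeq (m := k + 1) (a := 0) (x := x) hδ
        (fun i j h _ => hx i j h (by omega)) fun p hp => by
        rw [Nat.zero_add]; exact fun h => h0 ((hc' p (by omega) (by omega)).1 h)
      simp only [Nat.zero_add] at hd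
      obtain ⟨f, g, h, -⟩ := (hχ.two _ (hd.comp Fin.rev_strictAnti)).stepUp_of_strictAnti hδ hv hd
      exact ⟨f, g, h⟩
  · push Not at hc
    obtain ⟨p, -, hp, h⟩ := hc
    refine ⟨natEmb (fun i => i) (fun i j h _ => h) (by omega),
      natEmb (fun i => i + 1) (fun i j h _ => by omega) (by omega),
      stepUp_ne_of_shape ⟨p, by omega⟩ ⟨p + 1, by omega⟩ ⟨p + 1 + 1, by omega⟩ fun h' => ?_⟩
    change (Ascent δ x p ↔ Ascent δ x (p + 1)) at h'
    tauto

/-- Three colors appear on `k + 3` vertices unless the up-down word of the splitting points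
alternates: the windows starting at `0`, `1`, `2` give three shapes unless the word has period two
or is constant up to its first or last letter, in which case `k + 2` of the vertices have monotone
splitting points. -/
lemma seesThree_stepUp_or_alternating (hδ : IsSplitting δ) (hχ : IsGood χ) (hk : 2 ≤ k)
    {x : ℕ → W} (hx : ∀ i j, i < j → j < k + 3 → x i < x j) :
    SeesThree (stepUp δ χ) (fun i : Fin (k + 3) => x i) ∨
      ∀ p, p < k → (Ascent δ x (p + 1) ↔ ¬ Ascent δ x p) := by
  have hv : StrictMono (fun i : Fin (k + 3) => x i) := fun i j hij => hx i j hij j.2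
  let f₀ : Fin (k + 1) ↪o Fin (k + 3) := natEmb (fun i => i) (fun i j h _ => h) (by omega)
  let f₁ : Fin (k + 1) ↪o Fin (k + 3) :=
    natEmb (fun i => i + 1) (fun i j h _ => by omega) (by omega)
  let f₂ : Fin (k + 1) ↪o Fin (k + 3) :=
    natEmb (fun i => i + 2) (fun i j h _ => by omega) (by omega)
  -- All letters but possibly the last one agree.
  have key₁ : (∀ p, 0 ≤ p → p + 1 < k → (Ascent δ x p ↔ Ascent δ x (p + 1))) →
      SeesThree (stepUp δ χ) (fun i : Fin (k + 3) => x i) := by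
    intro hc
    have hc' := iff_of_iff_succ hc
    by_cases h0 : Ascent δ x 0 <;> by_cases hl : Ascent δ x k
    · have hd := strictMono_deltaSeq (m := k + 2) (a := 0) (x := x) (δ := δ) fun p hp => by
        rw [Nat.zero_add]
        rcases Nat.lt_or_ge p k with h | h
        · exact (hc' p (by omega) h).2 h0
        · rwa [show p = k by omega]
      simp only [Nat.zero_add] at hd
      exact (hχ.three _ hd).stepUp_of_strictMono hδ hv hd
    · have hd := strictMono_deltaSeq (m := k + 1) (a := 0) (x := x) (δ := δ) fun p hp => by
        rw [Nat.zero_add]; exact (hc' p (by omega) (by omega)).2 h0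
      simp only [Nat.zero_add] at hd
      refine .of_strictMono_comp hδ hχ hv (natEmb (fun i => i) (fun i j h _ => h) (by omega)) hd
        f₂ (k - 2) (by omega) ?_
      change ¬ Ascent δ x (k - 2 + 2)
      rwa [Nat.sub_add_cancel hk]
    · have hd := strictAnti_deltaSeq (m := k + 1) (a := 0) (x := x) hδ
        (fun i j h _ => hx i j h (by omega)) fun p hp => by
        rw [Nat.zero_add]; exact fun h => h0 ((hc' p (by omega) (by omega)).1 h)
      simp only [Nat.zero_add] at hd
      refine .of_strictAnti_comp hδ hχ hv (natEmb (fun i => i) (fun i j h _ => h) (by omega)) hd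
        f₂ (k - 2) (by omega) ?_
      change Ascent δ x (k - 2 + 2)
      rwa [Nat.sub_add_cancel hk]
    · have hd := strictAnti_deltaSeq (m := k + 2) (a := 0) (x := x) hδ
        (fun i j h _ => hx i j h (by omega)) fun p hp => by
        rw [Nat.zero_add]
        rcases Nat.lt_or_ge p k with h | h
        · exact fun h' => h0 ((hc' p (by omega) h).1 h')
        · rwa [show p = k by omega]
      simp only [Nat.zero_add] at hd
      exact (hχ.three _ (hd.comp Fin.rev_strictAnti)).stepUp_of_strictAnti hδ hv hd
  by_cases hc₁ : ∀ p, 0 ≤ p → p + 1 < k → (Ascent δ x p ↔ Ascent δ x (p + 1))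
  · exact Or.inl (key₁ hc₁)
  -- All letters but the first one agree.
  by_cases hc₂ : ∀ p, 1 ≤ p → p + 1 < k + 1 → (Ascent δ x p ↔ Ascent δ x (p + 1))
  · left
    have hc' := iff_of_iff_succ hc₂
    have h01 : ¬ (Ascent δ x 0 ↔ Ascent δ x 1) := by
      refine fun h01 => hc₁ fun p _ hp => ?_
      rcases Nat.eq_zero_or_pos p with rfl | h
      · exact h01
      · exact hc₂ p h (by omega)
    by_cases h1 : Ascent δ x 1
    · have hd := strictMono_deltaSeq (m := k + 1) (a := 1) (x := x) (δ := δ) fun p hp =>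
        (hc' (1 + p) (by omega) (by omega)).2 h1
      refine .of_strictMono_comp hδ hχ hv
        (natEmb (fun i => 1 + i) (fun i j h _ => by omega) (by omega)) hd f₀ 0 (by omega) ?_
      change ¬ Ascent δ x 0
      tauto
    · have hd := strictAnti_deltaSeq (m := k + 1) (a := 1) (x := x) hδ
        (fun i j h _ => hx i j h (by omega)) fun p hp h =>
        h1 ((hc' (1 + p) (by omega) (by omega)).1 h)
      refine .of_strictAnti_comp hδ hχ hv
        (natEmb (fun i => 1 + i) (fun i j h _ => by omega) (by omega)) hd f₀ 0 (by omega) ?_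
      change Ascent δ x 0
      tauto
  -- The word has period two.
  by_cases hc₃ : ∀ p, p + 1 < k → (Ascent δ x p ↔ Ascent δ x (p + 2))
  · right
    have h01 : ¬ (Ascent δ x 0 ↔ Ascent δ x 1) := by
      refine fun h01 => hc₁ fun p _ => ?_
      induction p with
      | zero => exact fun _ => h01
      | succ p ih =>
        intro hp
        exact (ih (by omega) (by omega)).symm.trans (hc₃ p (by omega))
    intro p
    induction p with
    | zero => intro _; rw [Nat.zero_add]; tauto
    | succ p ih =>
      intro hp
      have := ih (by omega)
      have := hc₃ p (by omega)
      tauto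
  · left
    push Not at hc₁ hc₂ hc₃
    obtain ⟨p, -, hp, h₁⟩ := hc₁
    obtain ⟨q, hq1, hq, h₂⟩ := hc₂
    obtain ⟨r, hr, h₃⟩ := hc₃
    obtain ⟨q, rfl⟩ := Nat.exists_eq_add_of_le' hq1
    refine ⟨f₀, f₁, f₂,
      stepUp_ne_of_shape ⟨p, by omega⟩ ⟨p + 1, by omega⟩ ⟨p + 1 + 1, by omega⟩ fun h' => ?_,
      stepUp_ne_of_shape ⟨q, by omega⟩ ⟨q + 1, by omega⟩ ⟨q + 1 + 1, by omega⟩ fun h' => ?_,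
      stepUp_ne_of_shape ⟨r, by omega⟩ ⟨r + 1, by omega⟩ ⟨r + 1 + 1, by omega⟩ fun h' => ?_⟩
    · change (Ascent δ x p ↔ Ascent δ x (p + 1)) at h'
      tauto
    · change (Ascent δ x (q + 1) ↔ Ascent δ x (q + 2)) at h'
      tauto
    · change (Ascent δ x r ↔ Ascent δ x (r + 2)) at h'
      tauto

end

/-! ### Alternating words -/

section
variable [LinearOrder V] {δ : W → W → V}

/-- A selection whose splitting points ascend twice or descend twice has a color different from
that of an initial segment with alternating up-down word. -/
lemma stepUp_ne_of_alternating {χ : (Fin k → V) → C} {x y : ℕ → W}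
    (halt : ∀ p, p < k → (Ascent δ x (p + 1) ↔ ¬ Ascent δ x p)) {a : ℕ} (ha : a ≤ 1)
    {p : ℕ} (hp : p + 2 < k) (hy : Ascent δ y p ↔ Ascent δ y (p + 1)) :
    stepUp δ χ (fun i : Fin (k + 1) => x (a + i)) ≠ stepUp δ χ (fun i : Fin (k + 1) => y i) := by
  have := halt (a + p) (by omega)
  by_cases h : Ascent δ y p ↔ Ascent δ x (a + p)
  · refine stepUp_ne_of_shape ⟨p + 1, by omega⟩ ⟨p + 1 + 1, by omega⟩ ⟨p + 1 + 1 + 1, by omega⟩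
      fun h' => ?_
    change (Ascent δ x (a + p + 1) ↔ Ascent δ y (p + 1)) at h'
    tauto
  · refine stepUp_ne_of_shape ⟨p, by omega⟩ ⟨p + 1, by omega⟩ ⟨p + 1 + 1, by omega⟩ fun h' => ?_
    change (Ascent δ x (a + p) ↔ Ascent δ y p) at h'
    tauto

/-- If the up-down word alternates, its two windows of length `k + 1` have different shapes, and a
selection `f` with a repeated letter supplies the third. -/
lemma seesThree_of_alternating {χ : (Fin k → V) → C} (hk : 3 ≤ k) {x : ℕ → W}
    (halt : ∀ p, p < k → (Ascent δ x (p + 1) ↔ ¬ Ascent δ x p))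
    (f : ℕ → ℕ) (hf : ∀ i j, i < j → j < k + 1 → f i < f j) (hb : ∀ i < k + 1, f i < k + 3)
    {p : ℕ} (hp : p + 2 < k) (hy : Ascent δ (x ∘ f) p ↔ Ascent δ (x ∘ f) (p + 1)) :
    SeesThree (stepUp δ χ) (fun i : Fin (k + 3) => x i) := by
  refine ⟨natEmb (fun i => 0 + i) (fun i j h _ => by omega) (by omega),
    natEmb (fun i => 1 + i) (fun i j h _ => by omega) (by omega), natEmb f hf hb,
    stepUp_ne_of_shape ⟨0, by omega⟩ ⟨1, by omega⟩ ⟨2, by omega⟩ fun h' => ?_,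
    stepUp_ne_of_alternating halt le_rfl hp hy,
    stepUp_ne_of_alternating halt (Nat.zero_le _) hp hy⟩
  change (Ascent δ x 0 ↔ Ascent δ x 1) at h'
  have := halt 0 (by omega)
  rw [Nat.zero_add] at this
  tauto

variable [LinearOrder W]

/-- Deleting the vertex `a + 2`, at a local maximum of the splitting points between two valleys,
leaves a word whose first letter is a descent and whose third letter is an ascent; whatever the
second letter is, it repeats one of them. -/
lemma descent_and_ascent_of_peak (hδ : IsSplitting δ) {x : ℕ → W} {a : ℕ}
    (hx : ∀ i j, i < j → j < a + 6 → x i < x j)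
    (h₀ : ¬ Ascent δ x a) (h₁ : Ascent δ x (a + 1))
    (h₃ : Ascent δ x (a + 3)) {y : ℕ → W} (hy0 : y 0 = x a) (hy1 : y 1 = x (a + 1))
    (hy2 : y 2 = x (a + 3)) (hy3 : y 3 = x (a + 4)) (hy4 : y 4 = x (a + 5)) :
    ¬ Ascent δ y 0 ∧ Ascent δ y 2 := by
  have h13 := (hδ _ _ _ (hx (a + 1) (a + 2) (by omega) (by omega))
    (hx (a + 2) (a + 3) (by omega) (by omega))).2
  rw [min_eq_left (le_of_lt h₁)] at h13
  constructor
  · change ¬ δ (y 0) (y 1) < δ (y 1) (y 2)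
    rw [hy0, hy1, hy2, h13]
    exact h₀
  · change δ (y 2) (y 3) < δ (y 3) (y 4)
    rw [hy2, hy3, hy4]
    exact h₃

/-- For `k ≥ 4` an alternating word on `k + 3` vertices leaves room for deleting a vertex at an inner
local maximum and one further vertex at an end. -/
lemma seesThree_of_peak {χ : (Fin k → V) → C} (hδ : IsSplitting δ) (hk : 4 ≤ k) {x : ℕ → W}
    (hx : ∀ i j, i < j → j < k + 3 → x i < x j)
    (halt : ∀ p, p < k → (Ascent δ x (p + 1) ↔ ¬ Ascent δ x p)) {a : ℕ} (ha : a ≤ 1)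
    (h₀ : ¬ Ascent δ x a) :
    SeesThree (stepUp δ χ) (fun i : Fin (k + 3) => x i) := by
  let f : ℕ → ℕ := fun i => if i < 2 then a + i else a + i + 1
  have hf : ∀ i j, i < j → j < k + 1 → f i < f j := fun i j _ _ => by
    simp only [f]; split_ifs <;> omega
  have hb : ∀ i < k + 1, f i < k + 3 := fun i _ => by simp only [f]; split_ifs <;> omega
  have h₁ := halt a (by omega)
  have h₂ := halt (a + 1) (by omega)
  have h₃ := halt (a + 2) (by omega)
  obtain ⟨g₀, g₂⟩ := descent_and_ascent_of_peak hδ (fun i j h h' => hx i j h (by omega)) h₀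
    (by tauto) (by tauto) (y := x ∘ f) rfl rfl rfl rfl rfl
  by_cases g₁ : Ascent δ (x ∘ f) 1
  · exact seesThree_of_alternating (by omega) halt f hf hb (p := 1) (by omega) (by simp; tauto)
  · exact seesThree_of_alternating (by omega) halt f hf hb (p := 0) (by omega) (by simp; tauto)

/-- For `k = 3` the word `up, down, up, down` has no local maximum between two valleys, and the
comparison of non-consecutive splitting points in the shape is needed. -/
lemma seesThree_six {χ : (Fin 3 → V) → C} (hδ : IsSplitting δ) {x : ℕ → W}
    (hx : ∀ i j, i < j → j < 6 → x i < x j)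
    (halt : ∀ p, p < 3 → (Ascent δ x (p + 1) ↔ ¬ Ascent δ x p)) :
    SeesThree (stepUp δ χ) (fun i : Fin 6 => x i) := by
  have l₀ := halt 0 (by omega)
  have l₁ := halt 1 (by omega)
  have l₂ := halt 2 (by omega)
  have t₀ := hδ _ _ _ (hx 0 1 (by omega) (by omega)) (hx 1 2 (by omega) (by omega))
  have t₁ := hδ _ _ _ (hx 1 2 (by omega) (by omega)) (hx 2 3 (by omega) (by omega))
  have t₂ := hδ _ _ _ (hx 2 3 (by omega) (by omega)) (hx 3 4 (by omega) (by omega))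
  have t₃ := hδ _ _ _ (hx 2 4 (by omega) (by omega)) (hx 4 5 (by omega) (by omega))
  have h3 : 3 ≤ 3 := le_rfl
  by_cases h : Ascent δ x 0
  · have a₀ : δ (x 0) (x 1) < δ (x 1) (x 2) := h
    have a₁ : ¬ δ (x 1) (x 2) < δ (x 2) (x 3) := fun h' => l₀.1 h' h
    have a₂ : δ (x 2) (x 3) < δ (x 3) (x 4) := l₁.2 a₁
    have a₃ : ¬ δ (x 3) (x 4) < δ (x 4) (x 5) := fun h' => l₂.1 h' a₂
    rw [min_eq_left a₀.le] at t₀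
    rw [min_eq_left a₂.le] at t₂
    by_cases c₁ : δ (x 0) (x 1) < δ (x 2) (x 3)
    · refine seesThree_of_alternating h3 halt (fun i => if i < 1 then i else i + 1)
        (fun i j _ _ => by split_ifs <;> omega)
        (fun i _ => by split_ifs <;> omega) (p := 0) (by omega)
        (iff_of_true ?_ ?_)
      · change δ (x 0) (x 2) < δ (x 2) (x 3)
        rwa [t₀.2]
      · exact a₂
    by_cases c₂ : δ (x 2) (x 3) < δ (x 4) (x 5)
    -- The valley `δ (x 2) (x 3)` is the overall minimum: the outer windows have the same up-down
    -- word and differ only on the triple at positions `0, 2, 3`.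
    · refine ⟨natEmb (fun i => i) (fun i j h _ => h) (by omega),
        natEmb (fun i => i + 1) (fun i j h _ => by omega) (by omega),
        natEmb (fun i => i + 2) (fun i j h _ => by omega) (by omega),
        stepUp_ne_of_shape 0 1 2 fun h' => a₁ (h'.1 a₀),
        stepUp_ne_of_shape 0 1 2 fun h' => a₁ (h'.2 a₂),
        stepUp_ne_of_shape 0 2 3 fun h' => ?_⟩
      change δ (x 0) (x 2) < δ (x 2) (x 3) ↔ δ (x 2) (x 4) < δ (x 4) (x 5) at h'
      rw [t₀.2, t₂.2] at h'
      exact c₁ (h'.2 c₂)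
    · refine seesThree_of_alternating h3 halt (fun i => if i < 2 then i + 1 else i + 2)
        (fun i j _ _ => by split_ifs <;> omega)
        (fun i _ => by split_ifs <;> omega) (p := 0) (by omega)
        (iff_of_false ?_ ?_)
      · change ¬ δ (x 1) (x 2) < δ (x 2) (x 4)
        rwa [t₂.2]
      · change ¬ δ (x 2) (x 4) < δ (x 4) (x 5)
        rwa [t₂.2]
  · obtain ⟨g₀, g₂⟩ := descent_and_ascent_of_peak hδ (a := 0) (fun i j h h' => hx i j h (by omega)) h
      (by tauto) (by tauto) (y := fun i => if i < 2 then x i else x (i + 1)) rfl rfl rfl rfl rfl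
    by_cases g₁ : Ascent δ (fun i => if i < 2 then x i else x (i + 1)) 1
    · exact seesThree_of_alternating h3 halt (fun i => if i < 1 then i + 1 else i + 2)
        (fun i j _ _ => by split_ifs <;> omega)
        (fun i _ => by split_ifs <;> omega) (p := 0) (by omega)
        (iff_of_true g₁ g₂)
    · exact seesThree_of_alternating h3 halt (fun i => if i < 2 then i else i + 1)
        (fun i j _ _ => by split_ifs <;> omega)
        (fun i _ => by split_ifs <;> omega) (p := 0) (by omega)
        (iff_of_false g₀ g₁)

/-- The step-up from `k` to `k + 1` for `k ≥ 3`. -/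
theorem IsGood.stepUp {χ : (Fin k → V) → C} (hδ : IsSplitting δ) (hχ : IsGood χ) (hk : 3 ≤ k) :
    IsGood (stepUp δ χ) where
  two := seesTwo_stepUp hδ hχ
  three v hv := by
    have : Nonempty W := ⟨v 0⟩
    obtain ⟨x, rfl⟩ := exists_nat_extension v
    have hx : ∀ i j, i < j → j < k + 3 → x i < x j := fun i j hij hj =>
      hv (a := ⟨i, by omega⟩) (b := ⟨j, hj⟩) hij
    refine (seesThree_stepUp_or_alternating hδ hχ (by omega) hx).elim id fun halt => ?_
    rcases Nat.lt_or_ge 3 k with h4 | h3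
    · by_cases h : Ascent δ x 0
      · exact seesThree_of_peak hδ h4 hx halt le_rfl fun h1 => (halt 0 (by omega)).1 h1 h
      · exact seesThree_of_peak hδ h4 hx halt (Nat.zero_le 1) h
    · obtain rfl : k = 3 := by omega
      exact seesThree_six hδ hx halt

/-! ### From graphs to triples -/

/-- No points `r < a`, `r < b < c` satisfy both `χ(ra) = χ(bc)` and `χ(rb) = χ(rc)`. The point `a`
may coincide with `b` or `c`, so monochromatic triangles are excluded as well. -/
def IsForkFree (χ : (Fin 2 → V) → C) : Prop :=
  ∀ r a b c, r < a → r < b → b < c → χ ![r, a] = χ ![b, c] → χ ![r, b] ≠ χ ![r, c]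

/-- The alternating case of the step from graphs to triples. Unless `k + 2 = 4` of the vertices have
monotone splitting points, the edges of the two orientations carry the colors of `ra, bc` and of
`rb, rc`, where `r` is the smallest splitting point, and `IsForkFree` applies. -/
lemma seesThree_five {χ : (Fin 2 → V) → C} (hδ : IsSplitting δ) (hχ : IsGood χ)
    (hf : IsForkFree χ) {x : ℕ → W}
    (hx : ∀ i j, i < j → j < 5 → x i < x j)
    (halt : ∀ p, p < 2 → (Ascent δ x (p + 1) ↔ ¬ Ascent δ x p)) :
    SeesThree (stepUp δ χ) (fun i : Fin 5 => x i) := by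
  have hv : StrictMono (fun i : Fin 5 => x i) := fun i j hij => hx i j hij j.2
  have l₀ := halt 0 (by omega)
  have l₁ := halt 1 (by omega)
  have t₀ := hδ _ _ _ (hx 0 1 (by omega) (by omega)) (hx 1 2 (by omega) (by omega))
  have t₁ := hδ _ _ _ (hx 1 2 (by omega) (by omega)) (hx 2 3 (by omega) (by omega))
  have t₂ := hδ _ _ _ (hx 2 3 (by omega) (by omega)) (hx 3 4 (by omega) (by omega))
  have t₃ := hδ _ _ _ (hx 1 2 (by omega) (by omega)) (hx 2 4 (by omega) (by omega))
  let v : Fin 5 → W := fun i => x i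
  let e₀₁₂ : Fin 3 ↪o Fin 5 := natEmb (fun i => i) (fun i j h _ => h) (by omega)
  let e₁₂₃ : Fin 3 ↪o Fin 5 := natEmb (fun i => i + 1) (fun i j h _ => by omega) (by omega)
  let e₂₃₄ : Fin 3 ↪o Fin 5 := natEmb (fun i => i + 2) (fun i j h _ => by omega) (by omega)
  let e₀₁₃ : Fin 3 ↪o Fin 5 := natEmb (fun i => if i < 2 then i else i + 1)
    (fun i j _ _ => by split_ifs <;> omega)
    (fun i _ => by split_ifs <;> omega)
  let e₁₃₄ : Fin 3 ↪o Fin 5 := natEmb (fun i => if i < 1 then i + 1 else i + 2)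
    (fun i j _ _ => by split_ifs <;> omega)
    (fun i _ => by split_ifs <;> omega)
  have pair : ∀ d : Fin 2 → V, ∀ a b, d 0 = a → d 1 = b → d = ![a, b] := by
    rintro d a b rfl rfl
    funext i
    fin_cases i <;> rfl
  by_cases h : Ascent δ x 0
  · have a₀ : δ (x 0) (x 1) < δ (x 1) (x 2) := h
    have a₁ : ¬ δ (x 1) (x 2) < δ (x 2) (x 3) := fun h' => l₀.1 h' h
    have a₂ : δ (x 2) (x 3) < δ (x 3) (x 4) := l₁.2 a₁
    rw [min_eq_left a₀.le] at t₀
    rw [min_eq_right (not_lt.1 a₁)] at t₁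
    by_cases c : δ (x 0) (x 1) < δ (x 2) (x 3)
    · refine .of_strictMono_comp hδ hχ hv (natEmb (fun i => if i < 1 then i else i + 1)
        (fun i j _ _ => by split_ifs <;> omega)
        (fun i _ => by split_ifs <;> omega)) ?_ e₁₂₃ 0 (by omega) a₁
      refine Fin.strictMono_iff_lt_succ.2 fun i => ?_
      fin_cases i
      · change δ (x 0) (x 2) < δ (x 2) (x 3)
        rwa [t₀.2]
      · exact a₂
    · have c' : δ (x 2) (x 3) < δ (x 0) (x 1) := by
        have := hδ _ _ _ (hx 0 2 (by omega) (by omega)) (hx 2 3 (by omega) (by omega))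
        rw [t₀.2] at this
        exact lt_of_le_of_ne (not_lt.1 c) this.1.symm
      have n₁ : ¬ δ (x 0) (x 1) < δ (x 1) (x 3) := by rw [t₁.2]; exact c
      by_cases g : χ ![δ (x 2) (x 3), δ (x 3) (x 4)] = χ ![δ (x 0) (x 1), δ (x 1) (x 2)]
      · have g' := hf _ _ _ _ a₂ c' a₀ g
        refine ⟨e₀₁₃, e₁₂₃, e₀₁₂, stepUp_ne_of_deltaSeq_rev ?_,
          stepUp_ne_of_shape 0 1 2 fun h' => a₁ (h'.2 a₀),
          stepUp_ne_of_shape 0 1 2 fun h' => n₁ (h'.2 a₀)⟩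
        rw [pair (deltaSeq δ (v ∘ e₀₁₃) ∘ Fin.rev) (δ (x 2) (x 3)) (δ (x 0) (x 1)) t₁.2 rfl,
          pair (deltaSeq δ (v ∘ e₁₂₃) ∘ Fin.rev) (δ (x 2) (x 3)) (δ (x 1) (x 2)) rfl rfl]
        exact g'
      · refine ⟨e₂₃₄, e₀₁₂, e₁₂₃, stepUp_ne_of_deltaSeq ?_,
          stepUp_ne_of_shape 0 1 2 fun h' => a₁ (h'.1 a₀),
          stepUp_ne_of_shape 0 1 2 fun h' => a₁ (h'.1 a₂)⟩
        rw [pair (deltaSeq δ (v ∘ e₂₃₄)) (δ (x 2) (x 3)) (δ (x 3) (x 4)) rfl rfl,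
          pair (deltaSeq δ (v ∘ e₀₁₂)) (δ (x 0) (x 1)) (δ (x 1) (x 2)) rfl rfl]
        exact g
  · have a₀ : ¬ δ (x 0) (x 1) < δ (x 1) (x 2) := h
    have a₁ : δ (x 1) (x 2) < δ (x 2) (x 3) := l₀.2 h
    have a₂ : ¬ δ (x 2) (x 3) < δ (x 3) (x 4) := fun h' => l₁.1 h' a₁
    have a₀' := hδ.lt_of_not_lt (hx 0 1 (by omega) (by omega)) (hx 1 2 (by omega) (by omega)) a₀
    have a₂' := hδ.lt_of_not_lt (hx 2 3 (by omega) (by omega)) (hx 3 4 (by omega) (by omega)) a₂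
    rw [min_eq_left a₁.le] at t₁
    rw [min_eq_right a₂'.le] at t₂
    rw [t₂.2] at t₃
    by_cases c : δ (x 1) (x 2) < δ (x 3) (x 4)
    · have n₁ : δ (x 1) (x 3) < δ (x 3) (x 4) := by rwa [t₁.2]
      by_cases g : χ ![δ (x 1) (x 2), δ (x 0) (x 1)] = χ ![δ (x 3) (x 4), δ (x 2) (x 3)]
      · have g' := hf _ _ _ _ a₀' c a₂' g
        refine ⟨e₁₃₄, e₁₂₃, e₀₁₂, stepUp_ne_of_deltaSeq ?_,
          stepUp_ne_of_shape 0 1 2 fun h' => a₀ (h'.1 a₁),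
          stepUp_ne_of_shape 0 1 2 fun h' => a₀ (h'.1 n₁)⟩
        rw [pair (deltaSeq δ (v ∘ e₁₃₄)) (δ (x 1) (x 2)) (δ (x 3) (x 4)) t₁.2 rfl,
          pair (deltaSeq δ (v ∘ e₁₂₃)) (δ (x 1) (x 2)) (δ (x 2) (x 3)) rfl rfl]
        exact g'
      · refine ⟨e₀₁₂, e₂₃₄, e₁₂₃, stepUp_ne_of_deltaSeq_rev ?_,
          stepUp_ne_of_shape 0 1 2 fun h' => a₂ (h'.2 a₁),
          stepUp_ne_of_shape 0 1 2 fun h' => a₀ (h'.2 a₁)⟩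
        rw [pair (deltaSeq δ (v ∘ e₀₁₂) ∘ Fin.rev) (δ (x 1) (x 2)) (δ (x 0) (x 1)) rfl rfl,
          pair (deltaSeq δ (v ∘ e₂₃₄) ∘ Fin.rev) (δ (x 3) (x 4)) (δ (x 2) (x 3)) rfl rfl]
        exact g
    · refine .of_strictAnti_comp hδ hχ hv (natEmb (fun i => if i < 3 then i else i + 1)
        (fun i j _ _ => by split_ifs <;> omega)
        (fun i _ => by split_ifs <;> omega)) ?_ e₁₂₃ 0 (by omega) a₁
      refine Fin.strictAnti_iff_succ_lt.2 fun i => ?_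
      fin_cases i
      · exact a₀'
      · change δ (x 2) (x 4) < δ (x 1) (x 2)
        rw [t₂.2]
        exact lt_of_le_of_ne (not_lt.1 c) t₃.1.symm

/-- The step-up from graphs to triples. -/
theorem IsGood.stepUp_graph {χ : (Fin 2 → V) → C} (hδ : IsSplitting δ) (hχ : IsGood χ)
    (hf : IsForkFree χ) : IsGood (_root_.stepUp δ χ) where
  two := seesTwo_stepUp hδ hχ
  three v hv := by
    have : Nonempty W := ⟨v 0⟩
    obtain ⟨x, rfl⟩ := exists_nat_extension v
    have hx : ∀ i j, i < j → j < 5 → x i < x j := fun i j hij hj =>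
      hv (a := ⟨i, by omega⟩) (b := ⟨j, hj⟩) hij
    exact (seesThree_stepUp_or_alternating hδ hχ le_rfl hx).elim id
      (seesThree_five hδ hχ hf hx)

end

/-! ### The coloring of pairs -/

section
variable {ι B : Type*} [DecidableEq B]

/-- The set of coordinates in which two words agree. -/
def agreement (x y : ι → B) : ι → Bool := fun i => decide (x i = y i)

variable [Nonempty ι]

/-- A coordinate in which the agreement pattern `p` is `false`, if there is one. It depends only on
`p`, so pairs of equal color share their pivot. -/
noncomputable def pivot (p : ι → Bool) : ι := Classical.epsilon fun i => p i = false

/-- The color of a pair of words: in which coordinates they agree, and the unordered pair of their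
letters at one coordinate where they differ. -/
noncomputable def blockColor (x y : ι → B) : (ι → Bool) × Sym2 B :=
  (agreement x y, s(x (pivot (agreement x y)), y (pivot (agreement x y))))

lemma pivot_spec {x y : ι → B} (h : x ≠ y) :
    x (pivot (agreement x y)) ≠ y (pivot (agreement x y)) := by
  obtain ⟨i, hi⟩ := Function.ne_iff.1 h
  have := Classical.epsilon_spec (p := fun i => agreement x y i = false)
    ⟨i, by simpa [agreement] using hi⟩
  exact of_decide_eq_false this

lemma blockColor_eq {x y z w : ι → B} (h : blockColor x y = blockColor z w) :
    (∀ i, x i = y i ↔ z i = w i) ∧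
      s(x (pivot (agreement x y)), y (pivot (agreement x y))) =
        s(z (pivot (agreement x y)), w (pivot (agreement x y))) := by
  simp only [blockColor, Prod.mk.injEq] at h
  refine ⟨fun i => ?_, ?_⟩
  · have := congrFun h.1 i
    simpa [agreement] using this
  · rw [h.2, h.1]

/-- At the pivot of `r, a` the letter of `r` is that of exactly one of `b`, `c`, so `r` agrees there
with exactly one of them. -/
lemma blockColor_fork {r a b c : ι → B} (hra : r ≠ a)
    (h : blockColor r a = blockColor b c) : blockColor r b ≠ blockColor r c := by
  intro h'
  have h1 := (blockColor_eq h).2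
  have h2 := (blockColor_eq h').1 (pivot (agreement r a))
  have h3 := pivot_spec hra
  rw [Sym2.eq_iff] at h1
  grind

end

section
variable {ι B : Type*} [DecidableEq B] [Nonempty ι] [LinearOrder V]

theorem isForkFree_blockColor (e : V → ι → B) (he : Function.Injective e) :
    IsForkFree (fun u : Fin 2 → V => blockColor (e (u 0)) (e (u 1))) :=
  fun _ _ _ _ hra _ _ h => blockColor_fork (he.ne hra.ne) h

end

/-- Every coloring of the six edges `01, 02, 03, 12, 13, 23` of `K₄` with two colors contains a
monochromatic triangle, or a monochromatic perfect matching and two edges of equal color outside it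
that meet in the smallest vertex. -/
lemma two_coloring_false {a b c d e f : Bool}
    (t₁ : a = d → a ≠ b) (t₂ : a = e → a ≠ c) (t₃ : b = f → b ≠ c) (t₄ : d = f → d ≠ e)
    (m₁ : a = f → b ≠ c) (m₂ : b = e → a ≠ c) (m₃ : c = d → a ≠ b) : False := by
  cases a <;> cases b <;> cases c <;> cases d <;> cases e <;> cases f <;>
    first
    | exact t₁ rfl rfl | exact t₂ rfl rfl | exact t₃ rfl rfl | exact t₄ rfl rfl
    | exact m₁ rfl rfl | exact m₂ rfl rfl | exact m₃ rfl rfl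

/-- The pair of positions `i < j`. -/
def pairEmb {i j : Fin m} (h : i < j) : Fin 2 ↪o Fin m :=
  OrderEmbedding.ofStrictMono ![i, j] (by simp [StrictMono, Fin.forall_fin_two, h])

lemma comp_pairEmb {i j : Fin m} (h : i < j) (v : Fin m → V) : v ∘ pairEmb h = ![v i, v j] := by
  funext p
  fin_cases p <;> rfl

/-- Fork-freeness alone makes a graph coloring good: a two-coloring of `K₄` always contains a fork. -/
theorem IsForkFree.isGood [LinearOrder V] {χ : (Fin 2 → V) → C} (hχ : IsForkFree χ) :
    IsGood χ where
  two v hv := by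
    by_cases h : χ ![v 0, v 1] = χ ![v 1, v 2]
    · refine ⟨pairEmb (i := 0) (j := 1) (by decide), pairEmb (i := 0) (j := 2) (by decide), ?_⟩
      rw [comp_pairEmb, comp_pairEmb]
      exact hχ _ _ _ _ (hv (by decide)) (hv (by decide)) (hv (by decide)) h
    · refine ⟨pairEmb (i := 0) (j := 1) (by decide), pairEmb (i := 1) (j := 2) (by decide), ?_⟩
      rwa [comp_pairEmb, comp_pairEmb]
  three v hv := by
    classical
    obtain ⟨i', j', hij', hne⟩ : ∃ i' j' : Fin 4, i' < j' ∧ χ ![v 0, v 1] ≠ χ ![v i', v j'] := by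
      by_cases h : χ ![v 0, v 1] = χ ![v 1, v 2]
      · exact ⟨0, 2, by decide,
          hχ _ _ _ _ (hv (by decide)) (hv (by decide)) (hv (by decide)) h⟩
      · exact ⟨1, 2, by decide, h⟩
    by_contra hno
    have hall : ∀ i j : Fin 4, i < j →
        χ ![v i, v j] = χ ![v 0, v 1] ∨ χ ![v i, v j] = χ ![v i', v j'] := by
      intro i j hij
      by_contra h
      rw [not_or] at h
      refine hno ⟨pairEmb (i := 0) (j := 1) (by decide), pairEmb hij', pairEmb hij, ?_, ?_, ?_⟩
      · rwa [comp_pairEmb, comp_pairEmb]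
      · rw [comp_pairEmb, comp_pairEmb]; exact Ne.symm h.2
      · rw [comp_pairEmb, comp_pairEmb]; exact Ne.symm h.1
    obtain ⟨b, hb⟩ : ∃ b : Fin 4 → Fin 4 → Bool,
        ∀ i j, b i j = decide (χ ![v i, v j] = χ ![v 0, v 1]) := ⟨_, fun _ _ => rfl⟩
    have hinj : ∀ i j l m : Fin 4, i < j → l < m → b i j = b l m →
        χ ![v i, v j] = χ ![v l, v m] := by
      intro i j l m hij hlm h
      rw [hb, hb, decide_eq_decide] at h
      rcases hall i j hij with h1 | h1 <;> rcases hall l m hlm with h2 | h2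
      · rw [h1, h2]
      · rw [h1, h.1 h1]
      · rw [h2, h.2 h2]
      · rw [h1, h2]
    have F : ∀ r i j l, r < i → r < j → j < l → b r i = b j l → b r j ≠ b r l :=
      fun r i j l h₁ h₂ h₃ h h' => hχ _ _ _ _ (hv h₁) (hv h₂) (hv h₃)
        (hinj _ _ _ _ h₁ h₃ h) (hinj _ _ _ _ h₂ (h₂.trans h₃) h')
    exact two_coloring_false
      (F 0 1 1 2 (by decide) (by decide) (by decide))
      (F 0 1 1 3 (by decide) (by decide) (by decide))
      (F 0 2 2 3 (by decide) (by decide) (by decide))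
      (F 1 2 2 3 (by decide) (by decide) (by decide))
      (F 0 1 2 3 (by decide) (by decide) (by decide))
      (F 0 2 1 3 (by decide) (by decide) (by decide))
      (F 0 3 1 2 (by decide) (by decide) (by decide))

/-! ### Lexicographic splitting and existence of colorings -/

/-- In the lexicographic order on words, the first coordinate of difference is a splitting. -/
lemma exists_isSplitting (n : ℕ) [NeZero n] :
    ∃ δ : Lex (Fin n → Bool) → Lex (Fin n → Bool) → Fin n, IsSplitting δ := by
  have h : ∀ a b : Lex (Fin n → Bool), ∃ i : Fin n, a < b →
      (∀ j < i, a j = b j) ∧ a i < b i := by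
    intro a b
    by_cases hab : a < b
    · obtain ⟨i, hi⟩ := hab
      exact ⟨i, fun _ => hi⟩
    · exact ⟨0, fun h => absurd h hab⟩
  choose δ hδ using h
  refine ⟨δ, fun a b c hab hbc => ?_⟩
  obtain ⟨h1, h1'⟩ := hδ a b hab
  obtain ⟨h2, h2'⟩ := hδ b c hbc
  obtain ⟨h3, h3'⟩ := hδ a c (hab.trans hbc)
  have hlt : ∀ x y : Bool, x < y → x = false ∧ y = true := by decide
  replace h1' := hlt _ _ h1'
  replace h2' := hlt _ _ h2'
  replace h3' := hlt _ _ h3'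
  have hne : δ a b ≠ δ b c := fun h => by
    rw [← h, h1'.2] at h2'
    exact absurd h2'.1 (by decide)
  refine ⟨hne, ?_⟩
  rcases lt_trichotomy (δ a c) (min (δ a b) (δ b c)) with h | h | h
  · rw [lt_min_iff] at h
    rw [h1 _ h.1, h2 _ h.2, h3'.2] at h3'
    exact absurd h3'.1 (by decide)
  · exact h
  · rcases lt_or_gt_of_ne hne with h' | h'
    · rw [min_eq_left h'.le] at h
      have := h3 _ h
      rw [← h2 _ h', h1'.1, h1'.2] at this
      exact absurd this (by decide)
    · rw [min_eq_right h'.le] at h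
      have := h3 _ h
      rw [h1 _ h', h2'.1, h2'.2] at this
      exact absurd this (by decide)

lemma IsGood.comp [LinearOrder V] [LinearOrder W] {χ : (Fin k → V) → C} (hχ : IsGood χ)
    {φ : W → V} (hφ : StrictMono φ) {ψ : C → D} (hψ : Function.Injective ψ) :
    IsGood (fun u : Fin k → W => ψ (χ (φ ∘ u))) where
  two v hv := by
    obtain ⟨f, g, h⟩ := hχ.two _ (hφ.comp hv)
    exact ⟨f, g, hψ.ne h⟩
  three v hv := by
    obtain ⟨f, g, h, h₁, h₂, h₃⟩ := hχ.three _ (hφ.comp hv)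
    exact ⟨f, g, h, hψ.ne h₁, hψ.ne h₂, hψ.ne h₃⟩

/-- There is a good coloring of the `k`-subsets of an `n`-element set with `r` colors. -/
def HasGoodColoring (k n r : ℕ) : Prop := ∃ χ : (Fin k → Fin n) → Fin r, IsGood χ

lemma IsGood.hasGoodColoring [LinearOrder V] [Fintype V] [Fintype C] {χ : (Fin k → V) → C}
    (hχ : IsGood χ) {r : ℕ} (hn : n ≤ Fintype.card V) (hr : Fintype.card C ≤ r) :
    HasGoodColoring k n r :=
  ⟨_, hχ.comp ((Fintype.orderIsoFinOfCardEq V rfl).strictMono.comp (Fin.strictMono_castLE hn))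
    ((Fin.castLE_injective hr).comp (Fintype.equivFin C).injective)⟩

lemma HasGoodColoring.mono {n' r r' : ℕ} (h : HasGoodColoring k n r) (hn : n' ≤ n)
    (hr : r ≤ r') : HasGoodColoring k n' r' := by
  obtain ⟨χ, hχ⟩ := h
  exact hχ.hasGoodColoring (by simpa using hn) (by simpa using hr)

lemma card_stepUp_colors (k : ℕ) (C : Type*) [Fintype C] :
    Fintype.card ((Fin k → Fin k → Fin k → Bool) × C × C) =
      2 ^ (k * k * k) * (Fintype.card C * Fintype.card C) := by
  simp [← pow_mul, mul_assoc]

lemma HasGoodColoring.step {r : ℕ} (h : HasGoodColoring k n r) (hk : 3 ≤ k) (hn : n ≠ 0) :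
    HasGoodColoring (k + 1) (2 ^ n) (2 ^ ((k + 1) * (k + 1) * (k + 1)) * (r * r)) := by
  obtain ⟨χ, hχ⟩ := h
  have : NeZero n := ⟨hn⟩
  obtain ⟨δ, hδ⟩ := exists_isSplitting n
  have : Fintype (Lex (Fin n → Bool)) := inferInstanceAs (Fintype (Fin n → Bool))
  refine (hχ.stepUp hδ hk).hasGoodColoring ?_ ?_
  · have h1 : Fintype.card (Lex (Fin n → Bool)) = Fintype.card (Fin n → Bool) :=
      Fintype.card_congr ofLex
    rw [h1]
    simp
  · rw [card_stepUp_colors]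
    simp

lemma hasGoodColoring_three {t : ℕ} (ht : t ≠ 0) :
    HasGoodColoring 3 (2 ^ 2 ^ t ^ 2) (2 ^ 27 * (8 ^ t * 8 ^ t)) := by
  have : NeZero t := ⟨ht⟩
  have hc : Fintype.card (Fin t → Fin t → Bool) = 2 ^ t ^ 2 := by
    simp [← pow_mul, sq]
  let e : Fin (2 ^ t ^ 2) ≃ (Fin t → Fin t → Bool) := (Fintype.equivFinOfCardEq hc).symm
  obtain ⟨δ, hδ⟩ := exists_isSplitting (2 ^ t ^ 2)
  have : Fintype (Lex (Fin (2 ^ t ^ 2) → Bool)) :=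
    inferInstanceAs (Fintype (Fin (2 ^ t ^ 2) → Bool))
  have hf := isForkFree_blockColor e e.injective
  refine (hf.isGood.stepUp_graph hδ hf).hasGoodColoring ?_ ?_
  · have h1 : Fintype.card (Lex (Fin (2 ^ t ^ 2) → Bool)) =
        Fintype.card (Fin (2 ^ t ^ 2) → Bool) := Fintype.card_congr ofLex
    rw [h1]
    simp
  · rw [card_stepUp_colors]
    have h2 : Fintype.card (Sym2 (Fin t → Bool)) ≤ 2 ^ t * 2 ^ t := by
      refine (Fintype.card_le_of_surjective (fun p : (Fin t → Bool) × (Fin t → Bool) => s(p.1, p.2))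
        ?_).trans (by simp)
      intro z
      induction z with
      | _ x y => exact ⟨(x, y), rfl⟩
    have h3 : Fintype.card ((Fin t → Bool) × Sym2 (Fin t → Bool)) ≤ 8 ^ t := by
      rw [Fintype.card_prod]
      calc _ ≤ 2 ^ t * (2 ^ t * 2 ^ t) := Nat.mul_le_mul (by simp) h2
        _ = 8 ^ t := by rw [← mul_pow, ← mul_pow]; norm_num
    exact Nat.mul_le_mul_left _ (Nat.mul_le_mul h3 h3)

/-! ### Towers -/

/-- The tower of height `j` over `2 ^ t ^ 2`. -/
def tower : ℕ → ℕ → ℕ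
  | 0, t => 2 ^ t ^ 2
  | j + 1, t => 2 ^ tower j t

lemma one_le_tower (j t : ℕ) : 1 ≤ tower j t := by
  cases j <;> exact Nat.one_le_two_pow

/-- The step-up iterated: exponentially many colors in `t` suffice for tower-many vertices. -/
theorem exists_hasGoodColoring (j : ℕ) :
    ∃ A : ℕ, 1 ≤ A ∧ ∀ t : ℕ, t ≠ 0 → HasGoodColoring (j + 3) (tower (j + 1) t) (A ^ t) := by
  induction j with
  | zero =>
    refine ⟨2 ^ 27 * (8 * 8), by norm_num, fun t ht => (hasGoodColoring_three ht).mono le_rfl ?_⟩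
    rw [mul_pow, mul_pow]
    exact Nat.mul_le_mul_right _ (Nat.le_self_pow ht _)
  | succ j ih =>
    obtain ⟨A, hA, h⟩ := ih
    refine ⟨2 ^ ((j + 3 + 1) * (j + 3 + 1) * (j + 3 + 1)) * (A * A),
      Nat.mul_pos (by positivity) (Nat.mul_pos hA hA), fun t ht =>
      ((h t ht).step (by omega) (Nat.one_le_iff_ne_zero.1 (one_le_tower _ _))).mono le_rfl ?_⟩
    rw [mul_pow, mul_pow]
    exact Nat.mul_le_mul_right _ (Nat.le_self_pow ht _)

/-- Colorings of sequences restrict to colorings of edges through increasing enumeration. -/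
theorem HasGoodColoring.exists_isPQColoring {r : ℕ} (h : HasGoodColoring k n r) :
    ∃ χ : CompleteEdge (Fin n) k → Fin r, IsPQColoring (k + 2) 3 χ := by
  obtain ⟨χ, hχ⟩ := h
  refine ⟨fun e => χ (e.1.orderEmbOfFin e.2), fun S hS => ?_⟩
  obtain ⟨f, g, h, h₁, h₂, h₃⟩ := hχ.three _ (S.orderEmbOfFin hS).strictMono
  have key : ∀ f : Fin k ↪o Fin (k + 2), χ (S.orderEmbOfFin hS ∘ f) ∈
      (fun e : CompleteEdge (Fin n) k => χ (e.1.orderEmbOfFin e.2)) ''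
        {e : CompleteEdge (Fin n) k | e.1 ⊆ S} := by
    intro f
    let F := f.trans (S.orderEmbOfFin hS)
    have hF : (Finset.univ.map F.toEmbedding).card = k := by simp
    refine ⟨⟨Finset.univ.map F.toEmbedding, hF⟩, ?_, ?_⟩
    · intro z hz
      simp only [Finset.mem_map, Finset.mem_univ, true_and] at hz
      obtain ⟨i, rfl⟩ := hz
      exact Finset.orderEmbOfFin_mem S hS _
    · change χ _ = χ _
      congr 1
      exact (Finset.orderEmbOfFin_unique hF (f := F) (by simp)
        (OrderEmbedding.strictMono F)).symm
  calc 3 = ({χ (S.orderEmbOfFin hS ∘ f), χ (S.orderEmbOfFin hS ∘ g),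
        χ (S.orderEmbOfFin hS ∘ h)} : Set (Fin r)).ncard :=
        (Set.ncard_eq_three.2 ⟨_, _, _, h₁, h₃, h₂, rfl⟩).symm
    _ ≤ _ := Set.ncard_le_ncard (by
        rintro _ (rfl | rfl | rfl)
        exacts [key f, key g, key h]) (Set.toFinite _)

/-- The hypothesis that some coloring exists matters: the infimum of the empty set would be `0`. -/
theorem HasGoodColoring.one_le_erdosGyarfas {r : ℕ} (h : HasGoodColoring k n r) (hn : k ≤ n) :
    1 ≤ erdosGyarfas k n (k + 2) 3 := by
  have hne : {r : ℕ | ∃ χ : CompleteEdge (Fin n) k → Fin r, IsPQColoring (k + 2) 3 χ}.Nonempty :=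
    ⟨r, h.exists_isPQColoring⟩
  obtain ⟨χ, -⟩ := Nat.sInf_mem hne
  obtain ⟨S, -, hS⟩ := Finset.exists_subset_card_eq (s := (Finset.univ : Finset (Fin n)))
    (n := k) (by simpa using hn)
  exact (Nat.zero_le _).trans_lt (χ ⟨S, hS⟩).2

lemma two_mul_tower_le (j t : ℕ) : 2 * tower j t ≤ tower j (t + 1) := by
  induction j with
  | zero =>
    simp only [tower, ← pow_succ']
    exact Nat.pow_le_pow_right (by norm_num) (by rw [add_sq]; omega)
  | succ j ih =>
    simp only [tower, ← pow_succ']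
    refine Nat.pow_le_pow_right (by norm_num) ?_
    have := one_le_tower j t
    omega

lemma self_le_tower (j t : ℕ) : t ≤ tower j t := by
  induction t with
  | zero => exact Nat.zero_le _
  | succ t ih =>
    have := two_mul_tower_le j t
    have := one_le_tower j t
    omega

/-! ### Asymptotics -/

lemma half_le_log_two : (1 : ℝ) / 2 ≤ Real.log 2 := by
  have := Real.log_two_gt_d9
  linarith

/-- Each logarithm removes one level of the tower, up to decreasing `t` by one to absorb the
change of base. -/
lemma tower_le_iterate_log (j s : ℕ) {x : ℝ} (hx : (tower j (s + j) : ℝ) ≤ x) :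
    (tower 0 s : ℝ) ≤ Real.log^[j] x := by
  induction j generalizing x with
  | zero => exact hx
  | succ j ih =>
    rw [Function.iterate_succ_apply]
    refine ih ?_
    have h1 : ((tower (j + 1) (s + (j + 1)) : ℕ) : ℝ) = 2 ^ tower j (s + j + 1) := by
      simp [tower, add_assoc]
    have h2 : (2 * tower j (s + j) : ℝ) ≤ tower j (s + j + 1) := by
      exact_mod_cast two_mul_tower_le j (s + j)
    have h3 : (tower j (s + j + 1) : ℝ) * Real.log 2 ≤ Real.log x := by
      rw [← Real.log_pow]
      exact Real.log_le_log (by positivity) (h1 ▸ hx)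
    have h4 := half_le_log_two
    have h5 : (0 : ℝ) ≤ tower j (s + j + 1) := Nat.cast_nonneg _
    nlinarith

lemma sq_half_le_iterate_log (j s : ℕ) {x : ℝ} (hx : (tower j (s + j) : ℝ) ≤ x) :
    (s : ℝ) ^ 2 / 2 ≤ Real.log^[j + 1] x := by
  rw [Function.iterate_succ_apply']
  have h1 := tower_le_iterate_log j s hx
  have h2 : ((s ^ 2 : ℕ) : ℝ) * Real.log 2 ≤ Real.log (Real.log^[j] x) := by
    rw [← Real.log_pow]
    refine Real.log_le_log (by positivity) ?_
    simpa [tower] using h1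
  push_cast at h2
  have h4 := half_le_log_two
  nlinarith [sq_nonneg (s : ℝ)]

/-- The quantitative bound: if `t` is least with `n ≤ tower (j + 1) (t + 1)`, then `A ^ (t + 1)`
colors suffice, and `t` is at most a multiple of `√(log^[j + 2] n) + 1` because
`tower (j + 1) t < n` unless `t = 0`. -/
theorem exists_log_erdosGyarfas_le (j : ℕ) :
    ∃ K : ℝ, ∀ n : ℕ, j + 3 ≤ n → 1 ≤ erdosGyarfas (j + 3) n (j + 5) 3 ∧
      Real.log (erdosGyarfas (j + 3) n (j + 5) 3) ≤
        K * (√(Real.log^[j + 2] (n : ℝ)) + 1) := by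
  obtain ⟨A, hA, h⟩ := exists_hasGoodColoring j
  have hA' : (1 : ℝ) ≤ A := by exact_mod_cast hA
  refine ⟨(j + 3) * Real.log A, fun n hn => ?_⟩
  have hex : ∃ t : ℕ, n ≤ tower (j + 1) t := ⟨n, self_le_tower _ _⟩
  classical
  obtain ⟨t, ht, hmin⟩ : ∃ t, n ≤ tower (j + 1) (t + 1) ∧ (t ≠ 0 → tower (j + 1) t < n) := by
    rcases Nat.eq_zero_or_pos (Nat.find hex) with h0 | h0
    · refine ⟨0, ?_, fun h => absurd rfl h⟩
      have := Nat.find_spec hex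
      rw [h0] at this
      have := two_mul_tower_le (j + 1) 0
      rw [Nat.zero_add] at *
      omega
    · refine ⟨Nat.find hex - 1, ?_, fun _ => ?_⟩
      · rw [Nat.sub_add_cancel h0]; exact Nat.find_spec hex
      · exact not_le.1 (Nat.find_min hex (by omega))
  have hg := (h (t + 1) (Nat.succ_ne_zero t)).mono ht le_rfl
  have h1 : 1 ≤ erdosGyarfas (j + 3) n (j + 5) 3 := hg.one_le_erdosGyarfas hn
  refine ⟨h1, ?_⟩
  have h2 : erdosGyarfas (j + 3) n (j + 5) 3 ≤ A ^ (t + 1) := Nat.sInf_le hg.exists_isPQColoring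
  have h3 : Real.log (erdosGyarfas (j + 3) n (j + 5) 3) ≤ (t + 1) * Real.log A := by
    have : (erdosGyarfas (j + 3) n (j + 5) 3 : ℝ) ≤ (A : ℝ) ^ (t + 1) := by exact_mod_cast h2
    calc _ ≤ Real.log ((A : ℝ) ^ (t + 1)) :=
          Real.log_le_log (by exact_mod_cast h1) this
      _ = _ := by rw [Real.log_pow]; push_cast; ring
  have h4 : (t : ℝ) + 1 ≤ (j + 3) * (√(Real.log^[j + 2] (n : ℝ)) + 1) := by
    have hs := Real.sqrt_nonneg (Real.log^[j + 2] (n : ℝ))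
    have hj : (0 : ℝ) ≤ j := Nat.cast_nonneg j
    rcases Nat.lt_or_ge t (j + 2) with h | h
    · have : (t : ℝ) + 1 ≤ j + 2 := by exact_mod_cast h
      nlinarith
    · obtain ⟨s, rfl⟩ := Nat.exists_eq_add_of_le' h
      have h5 : (tower (j + 1) (s + (j + 1)) : ℝ) ≤ n := by
        have h6 := hmin (by omega)
        have h7 := two_mul_tower_le (j + 1) (s + (j + 1))
        have h8 : tower (j + 1) (s + (j + 1)) ≤ n := by
          rw [show s + (j + 1) + 1 = s + (j + 2) by ring] at h7
          omega
        exact_mod_cast h8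
      have h6 := sq_half_le_iterate_log (j + 1) s h5
      have h7 : (s : ℝ) / 2 ≤ √(Real.log^[j + 2] (n : ℝ)) := by
        refine Real.le_sqrt_of_sq_le (le_trans ?_ h6)
        nlinarith [sq_nonneg (s : ℝ)]
      push_cast
      nlinarith
  calc _ ≤ _ := h3
    _ ≤ _ := by
      rw [mul_right_comm]
      exact mul_le_mul_of_nonneg_right h4 (Real.log_nonneg hA')

lemma tendsto_iterate_log (j : ℕ) :
    Tendsto (fun n : ℕ => Real.log^[j] (n : ℝ)) atTop atTop :=
  (Real.tendsto_log_atTop.iterate j).comp tendsto_natCast_atTop_atTop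

theorem theorem1 (k : ℕ) (hk : 4 ≤ k) :
    (∃ h : ℕ → ℝ,
      h =O[atTop] (fun n : ℕ => √(Real.log^[k - 1] (n : ℝ))) ∧
      ∀ᶠ n : ℕ in atTop, (erdosGyarfas k n (k + 2) 3 : ℝ) = Real.exp (h n)) ∧
    (∃ ε : ℕ → ℝ,
      Tendsto ε atTop (𝓝 0) ∧
      ∀ᶠ n : ℕ in atTop,
        (erdosGyarfas k n (k + 2) 3 : ℝ) = (Real.log^[k - 2] (n : ℝ)) ^ (ε n)) := by
  obtain ⟨j, rfl⟩ := Nat.exists_eq_add_of_le' (show 3 ≤ k by omega)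
  rw [show j + 3 - 1 = j + 2 by omega, show j + 3 - 2 = j + 1 by omega]
  obtain ⟨K, hK⟩ := exists_log_erdosGyarfas_le j
  have hL := tendsto_iterate_log (j + 2)
  have hL' := tendsto_iterate_log (j + 1)
  have hpos : ∀ᶠ n : ℕ in atTop, (0 : ℝ) < erdosGyarfas (j + 3) n (j + 3 + 2) 3 := by
    filter_upwards [eventually_ge_atTop (j + 3)] with n hn
    exact_mod_cast (hK n hn).1
  have hO : (fun n : ℕ => Real.log (erdosGyarfas (j + 3) n (j + 3 + 2) 3)) =O[atTop]
      (fun n : ℕ => √(Real.log^[j + 2] (n : ℝ))) := by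
    refine IsBigO.of_bound (2 * |K|) ?_
    filter_upwards [eventually_ge_atTop (j + 3), hL.eventually_ge_atTop 1] with n hn h1
    obtain ⟨h2, h3⟩ := hK n hn
    have h4 : 1 ≤ √(Real.log^[j + 2] (n : ℝ)) := Real.one_le_sqrt.2 h1
    rw [Real.norm_of_nonneg (Real.log_nonneg (by exact_mod_cast h2)),
      Real.norm_of_nonneg (Real.sqrt_nonneg _)]
    refine h3.trans ?_
    nlinarith [le_abs_self K, abs_nonneg K]
  -- The exponent is `h n / log (log^[j + 1] n)`, and `√L = o(L)`.
  refine ⟨⟨_, hO, ?_⟩, fun n => Real.log (erdosGyarfas (j + 3) n (j + 3 + 2) 3) /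
    Real.log^[j + 2] (n : ℝ), ?_, ?_⟩
  · filter_upwards [hpos] with n hn
    rw [Real.exp_log hn]
  · refine IsLittleO.tendsto_div_nhds_zero (hO.trans_isLittleO ?_)
    have h1 : (fun x : ℝ => √x) =o[atTop] (fun x : ℝ => x) := by
      refine (isLittleO_iff_tendsto' ?_).2 ?_
      · filter_upwards [eventually_gt_atTop 0] with x hx h0
        exact absurd h0 hx.ne'
      · simp_rw [Real.sqrt_div_self]
        exact tendsto_inv_atTop_zero.comp Real.tendsto_sqrt_atTop
    exact h1.comp_tendsto hL
  · filter_upwards [hpos, hL.eventually_gt_atTop 0, hL'.eventually_gt_atTop 0] with n hn h1 h2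
    rw [Real.rpow_def_of_pos h2, ← Function.iterate_succ_apply' Real.log (j + 1) (n : ℝ),
      mul_div_cancel₀ _ h1.ne', Real.exp_log hn]
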